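/- Let $\mathbb{D}$ be the open unit disc in $\mathbb{C}$, let $dA$ be area measure, let $0<p<\infty$, and put $\delta_b(z)=1-|z|$. Let $w$ be a Bekollé–Bonami weight for some exponent $q$, $1<q<\infty$; that is, $w$ is a measurable function on $\mathbb{D}$, positive almost everywhere, for which there is a constant $K<\infty$ such that for every open disc $B\subset\mathbb{C}$ (of positive radius) whose closure meets the unit circle, \[ \Bigl(\frac1{|B|}\int_{B\cap\mathbb{D}} w\,dA\Bigr)\Bigl(\frac1{|B|}\int_{B\cap\mathbb{D}} w^{-1/(q-1)}\,dA\Bigr)^{q-1}\le K . \] Let $\|g\|=\bigl(\int_{\mathbb{D}}|g|^p\,w\,dA\bigr)^{1/p}\in[0,\infty]$ be the (quasi-)norm of $L^p(w\,dA)$. Suppose that for all sufficiently small $0<\eta<1$ the two operators \[ u\mapsto u\bigl(z+e^{i\arg z}\,\eta\,\delta_b(z)\bigr)\qquad\text{and}\qquad u\mapsto u\bigl(z+i\,e^{i\arg z}\,\eta\,\delta_b(z)\bigr) \] are bounded on real-valued harmonic functions in $\mathbb{D}$; that is, for each such $\eta$ there is a constant $C_\eta<\infty$ such that for every real-valued harmonic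 function $u$ on $\mathbb{D}$ the norms of the two functions of $z$ above are at most $C_\eta\|u\|$. Then the operator $u\mapsto\delta_b f'$ is bounded: there is a constant $C<\infty$ such that for every real-valued harmonic function $u$ on $\mathbb{D}$ and every analytic function $f$ on $\mathbb{D}$ with $\operatorname{Re} f=u$ one has \[ \|\delta_b f'\|\le C\,\|u\| . \] -/

import Mathlib

open MeasureTheory Metric Set
open scoped ENNReal NNReal

noncomputable section

/-- The open unit disc of the complex plane. -/
def unitDisc : Set ℂ := ball (0 : ℂ) 1

/-- `w` is a Bekollé–Bonami weight on the unit disc for the exponent `q`, `1 < q < ∞`: it is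
measurable and almost everywhere positive on the disc, and the products of averages of `w` and
`w ^ (-1 / (q - 1))` are bounded over all discs `B` whose closure meets the unit circle.
As `w` lives on the unit disc, the integrals over `B` are taken over the part of `B` in the
unit disc. -/
structure IsBekolleBonamiWeight (q : ℝ) (w : ℂ → ℝ) : Prop where
  one_lt : 1 < q
  aemeasurable : AEMeasurable w (volume.restrict unitDisc)
  pos : ∀ᵐ z ∂(volume.restrict unitDisc), 0 < w z
  bound : ∃ C : ℝ≥0, ∀ (c : ℂ) (r : ℝ), 0 < r →
    (closure (ball c r) ∩ sphere (0 : ℂ) 1).Nonempty →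
    ((volume (ball c r))⁻¹ * ∫⁻ z in ball c r ∩ unitDisc, ENNReal.ofReal (w z)) *
      ((volume (ball c r))⁻¹ *
        ∫⁻ z in ball c r ∩ unitDisc, ENNReal.ofReal (w z ^ (-1 / (q - 1)))) ^ (q - 1) ≤ C

/-- The measure `w dA` on the unit disc. -/
def weightedArea (w : ℂ → ℝ) : Measure ℂ :=
  (volume.restrict unitDisc).withDensity fun z => ENNReal.ofReal (w z)

/-- The (quasi-)norm of `L^p(w dA)`, that is `(∫ ‖g‖ ^ p w dA) ^ (1 / p)` over the unit disc,
with values in `[0, ∞]`. -/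
def weightedNorm {F : Type*} [NormedAddCommGroup F] (p : ℝ) (w : ℂ → ℝ) (g : ℂ → F) : ℝ≥0∞ :=
  eLpNorm g (ENNReal.ofReal p) (weightedArea w)

/-- The distance `1 - |z|` to the boundary of the unit disc. -/
def deltaB (z : ℂ) : ℝ := 1 - ‖z‖

/-- The operator taking `u` to `z ↦ u (z + ζ e^{i arg z} η (1 - |z|))`. -/
def shiftedEval (ζ : ℂ) (η : ℝ) (u : ℂ → ℝ) (z : ℂ) : ℝ :=
  u (z + ζ * Complex.exp (Complex.I * Complex.arg z) * η * deltaB z)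

/-- The operator `T` is bounded, in the norm of `L^p(w dA)`, on real harmonic functions in the
unit disc. -/
def IsBoundedOnHarmonic (p : ℝ) (w : ℂ → ℝ) (T : (ℂ → ℝ) → ℂ → ℝ) : Prop :=
  ∃ C : ℝ≥0, ∀ u : ℂ → ℝ, InnerProductSpace.HarmonicOnNhd u unitDisc →
    weightedNorm p w (T u) ≤ C * weightedNorm p w u

/-- `f` is an analytic completion of `u`: it is analytic in the unit disc with real part `u`
there. It is unique up to an imaginary constant, so that `f'` is determined by `u`. -/
def IsAnalyticCompletion (u : ℂ → ℝ) (f : ℂ → ℂ) : Prop :=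
  DifferentiableOn ℂ f unitDisc ∧ ∀ z ∈ unitDisc, (f z).re = u z

end

/-! The estimate is local at the scale `δ = deltaB z`. By Hardy–Littlewood, `|u|^s` has a sub-mean
value inequality up to a constant for every `s > 0`, and a gradient estimate bounds `f'` by the
supremum of `|u|`. Together, `δ² |δ f'(z)|^s ≤ C ∫ |u|^s` over the ball of radius `δ/2` about `z`.
Take `s = p/q`, raise to the power `q`, and apply Hölder to `|u|^s w^(1/q) · w^(-1/q)`. The
dual-weight factor is absorbed by the Bekollé–Bonami condition on `ball z (2δ)`, which gives `|δ
f'(z)|^p μ(ball z (2δ)) ≤ C ∫_{ball z (δ/2)} |u|^p dμ` with `μ = w dA`. Dividing by the mass and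
integrating in `z`, Tonelli's theorem finishes (`lintegral_le_of_mul_measure_ball_le`). -/

/-! ### Sub-mean value inequalities for powers of harmonic functions -/

open InnerProductSpace in
theorem HarmonicOnNhd.two_pi_mul_enorm_le_lintegral_circle {u : ℂ → ℝ} {c : ℂ} {r : ℝ}
    (hu : HarmonicOnNhd u (closedBall c |r|)) :
    ENNReal.ofReal (2 * Real.pi) * ‖u c‖ₑ ≤
      ∫⁻ θ in Ioo (-Real.pi) Real.pi, ‖u (circleMap c r θ)‖ₑ := by
  have h1 := InnerProductSpace.HarmonicOnNhd.circleAverage_eq hu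
  have h2 : (2 * Real.pi) * u c = ∫ θ in Ioo (-Real.pi) Real.pi, u (circleMap c r θ) := by
    -- Circle averages run over `[0, 2π]`, polar coordinates over `(-π, π)`; periodicity reconciles
    -- them.
    have hper : (fun θ ↦ u (circleMap c r θ)).Periodic (2 * Real.pi) :=
      fun x ↦ by simp [periodic_circleMap c r x]
    have h3 := hper.intervalIntegral_add_eq 0 (-Real.pi)
    rw [← h1, Real.circleAverage, smul_eq_mul, mul_inv_cancel_left₀ (by positivity)]
    rw [zero_add, show -Real.pi + 2 * Real.pi = Real.pi by ring] at h3
    rw [h3, intervalIntegral.integral_of_le (by linarith [Real.pi_pos]), integral_Ioc_eq_integral_Ioo]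
  calc ENNReal.ofReal (2 * Real.pi) * ‖u c‖ₑ = ‖(2 * Real.pi) * u c‖ₑ := by
        rw [enorm_mul, Real.enorm_of_nonneg (r := 2 * Real.pi) Real.two_pi_pos.le]
    _ ≤ _ := by rw [h2]; exact enorm_integral_le_lintegral_enorm _

theorem lintegral_ofReal_Ioo {R : ℝ} (hR : 0 < R) :
    ∫⁻ r in Ioo 0 R, ENNReal.ofReal r = ENNReal.ofReal (R ^ 2 / 2) := by
  rw [← ofReal_integral_eq_lintegral_ofReal]
  · rw [← integral_Ioc_eq_integral_Ioo, ← intervalIntegral.integral_of_le hR.le, integral_id]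
    simp
  · exact (continuous_id.integrableOn_Icc (a := 0) (b := R)).mono_set Ioo_subset_Icc_self
  · filter_upwards [ae_restrict_mem measurableSet_Ioo] with r hr using hr.1.le

open InnerProductSpace in
/-- The sub-mean value property of `|u|` over discs. -/
theorem HarmonicOnNhd.ofReal_sq_mul_enorm_le_lintegral_ball {u : ℂ → ℝ} {c : ℂ} {R : ℝ}
    (hR : 0 < R) (hu : HarmonicOnNhd u (ball c R)) :
    ENNReal.ofReal (Real.pi * R ^ 2) * ‖u c‖ₑ ≤ ∫⁻ z in ball c R, ‖u z‖ₑ := by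
  set F : ℂ → ℝ≥0∞ := (ball c R).indicator fun z ↦ ‖u z‖ₑ with hF
  have hFm : Measurable F := by
    classical
    have h := (hu.continuousOn.measurable_piecewise
      (g := fun _ ↦ (0 : ℝ)) continuousOn_const measurableSet_ball).enorm
    convert h using 1
    ext z
    by_cases hz : z ∈ ball c R <;> simp [hF, hz]
  rw [← lintegral_indicator measurableSet_ball, ← lintegral_add_left_eq_self _ c,
    ← Complex.lintegral_comp_polarCoord_symm, polarCoord_target, Measure.volume_eq_prod,
    setLIntegral_prod]
  · have hsub : Ioo 0 R ⊆ Ioi 0 := fun _ h ↦ h.1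
    refine le_trans ?_ (lintegral_mono_set hsub)
    have key : ∀ r ∈ Ioo 0 R, ENNReal.ofReal r * (ENNReal.ofReal (2 * Real.pi) * ‖u c‖ₑ) ≤
        ∫⁻ θ in Ioo (-Real.pi) Real.pi,
          ENNReal.ofReal r • F (c + Complex.polarCoord.symm (r, θ)) := by
      intro r hr
      have hb : closedBall c |r| ⊆ ball c R := by
        rw [abs_of_pos hr.1]; exact closedBall_subset_ball hr.2
      simp_rw [smul_eq_mul]
      rw [lintegral_const_mul']
      · gcongr
        refine (HarmonicOnNhd.two_pi_mul_enorm_le_lintegral_circle (hu.mono hb)).trans_eq ?_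
        refine lintegral_congr fun θ ↦ ?_
        have : c + Complex.polarCoord.symm (r, θ) = circleMap c r θ := by
          simp [circleMap, Complex.exp_mul_I]
        rw [this, hF, indicator_of_mem (hb (sphere_subset_closedBall
          (circleMap_mem_sphere' c r θ)))]
      · exact ENNReal.ofReal_ne_top
    refine le_trans ?_ (setLIntegral_mono' measurableSet_Ioo key)
    rw [lintegral_mul_const' _ _ (by finiteness), lintegral_ofReal_Ioo hR, ← mul_assoc,
      ← ENNReal.ofReal_mul (by positivity)]
    rw [show R ^ 2 / 2 * (2 * Real.pi) = Real.pi * R ^ 2 by ring]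
  · apply Measurable.aemeasurable
    have : Measurable fun p : ℝ × ℝ ↦ Complex.polarCoord.symm p := by
      simp_rw [Complex.polarCoord_symm_apply]; fun_prop
    simp_rw [smul_eq_mul]
    exact (measurable_fst.ennreal_ofReal).mul (hFm.comp (this.const_add c))

open InnerProductSpace in
/-- The Hardy–Littlewood inequality for small powers of a harmonic function. -/
theorem exists_enorm_rpow_le_lintegral_ball_of_le_one {s : ℝ} (hs : 0 < s) (hs1 : s ≤ 1) :
    ∃ C : ℝ≥0, ∀ (u : ℂ → ℝ) (c : ℂ) (R : ℝ), 0 < R → HarmonicOnNhd u (closedBall c R) →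
      ∀ x ∈ ball c (R / 2),
        ENNReal.ofReal (R ^ 2) * ‖u x‖ₑ ^ s ≤ C * ∫⁻ z in ball c R, ‖u z‖ₑ ^ s := by
  set K : ℝ≥0∞ := ENNReal.ofReal (2 ^ (2 / s)) with hK
  have hKt : K ≠ ∞ := ENNReal.ofReal_ne_top
  refine ⟨(16 * K ^ (1 - s)).toNNReal, fun u c R hR hu x hx ↦ ?_⟩
  rw [ENNReal.coe_toNNReal (by
    have := ENNReal.rpow_ne_top_of_nonneg (sub_nonneg.2 hs1) hKt; finiteness)]
  have hs2 : 0 < 2 / s := by positivity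
  -- The exponent `2 / s` makes the `s`-th power of the maximised quantity `(R - dist y c)² |u
  -- y|^s`, which scales like an area integral.
  obtain ⟨x₀, hx₀, hmax⟩ := (isCompact_closedBall c R).exists_isMaxOn
    (f := fun y ↦ (R - dist y c) ^ (2 / s) * |u y|) ⟨c, mem_closedBall_self hR.le⟩ (by
      refine ContinuousOn.mul ?_ hu.continuousOn.abs
      exact (Continuous.rpow_const (by fun_prop) fun _ ↦ Or.inr hs2.le).continuousOn)
  rw [isMaxOn_iff] at hmax
  have hxc : dist x c < R / 2 := hx
  have hxu := hmax x (mem_closedBall.2 (by linarith))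
  set d : ℝ := R - dist x₀ c with hd
  have hd0 : 0 ≤ d := by have := mem_closedBall.1 hx₀; linarith
  set I : ℝ≥0∞ := ∫⁻ z in ball c R, ‖u z‖ₑ ^ s with hI
  set a : ℝ≥0∞ := ‖u x₀‖ₑ with ha
  have hat : a ≠ ∞ := enorm_ne_top
  have hstep1 : ENNReal.ofReal (R ^ 2 / 4) * ‖u x‖ₑ ^ s ≤ ENNReal.ofReal (d ^ 2) * a ^ s := by
    have h1 : (R / 2) ^ (2 / s) * |u x| ≤ d ^ (2 / s) * |u x₀| := by
      refine le_trans ?_ hxu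
      gcongr
      linarith
    have h2 := Real.rpow_le_rpow (by positivity) h1 hs.le
    rw [Real.mul_rpow (by positivity) (abs_nonneg _), Real.mul_rpow (by positivity) (abs_nonneg _),
      ← Real.rpow_mul (by positivity), ← Real.rpow_mul hd0, div_mul_cancel₀ _ hs.ne'] at h2
    have h3 := ENNReal.ofReal_le_ofReal h2
    rw [ENNReal.ofReal_mul (by positivity), ENNReal.ofReal_mul (by positivity),
      ← ENNReal.ofReal_rpow_of_nonneg (abs_nonneg _) hs.le,
      ← ENNReal.ofReal_rpow_of_nonneg (abs_nonneg _) hs.le, ← Real.norm_eq_abs, ← Real.norm_eq_abs,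
      ofReal_norm, ofReal_norm] at h3
    convert h3 using 3
    · norm_num; ring
    · norm_num
  have hstep2 : ENNReal.ofReal (d ^ 2) * a ^ s ≤ 4 * K ^ (1 - s) * I := by
    rcases eq_or_ne a 0 with ha0 | ha0
    · simp [ha0, hs]
    rcases hd0.eq_or_lt with hd0 | hd0
    · simp [← hd0]
    have hsub : ball x₀ (d / 2) ⊆ ball c R := ball_subset_ball' (by linarith)
    -- Here the distance to the boundary of `ball c R` is at least `d / 2`, so maximality gives `|u|
    -- ≤ K a`. This trades `|u|` for `|u|^s`; the surplus `a ^ (1 - s)` cancels below.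
    have hle : ∀ y ∈ ball x₀ (d / 2), ‖u y‖ₑ ≤ (K * a) ^ (1 - s) * ‖u y‖ₑ ^ s := by
      intro y hy
      have hyc := hmax y (ball_subset_closedBall (hsub hy))
      have hyd : d / 2 ≤ R - dist y c := by
        have := dist_triangle y x₀ c
        have := mem_ball.1 hy
        linarith
      have h1 : |u y| ≤ 2 ^ (2 / s) * |u x₀| := by
        have h2 : (d / 2) ^ (2 / s) * |u y| ≤ d ^ (2 / s) * |u x₀| := by
          refine le_trans ?_ hyc
          gcongr
        rw [Real.div_rpow hd0.le two_pos.le] at h2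
        have h4 : 0 < d ^ (2 / s) := by positivity
        have h5 : (0 : ℝ) < 2 ^ (2 / s) := by positivity
        rw [div_mul_eq_mul_div, div_le_iff₀ h5] at h2
        nlinarith
      have h2 : ‖u y‖ₑ ≤ K * a := by
        have := ENNReal.ofReal_le_ofReal h1
        rwa [ENNReal.ofReal_mul (by positivity), ← Real.norm_eq_abs, ← Real.norm_eq_abs,
          ofReal_norm, ofReal_norm] at this
      calc ‖u y‖ₑ = ‖u y‖ₑ ^ (1 - s) * ‖u y‖ₑ ^ s := by
            rw [← ENNReal.rpow_add_of_nonneg _ _ (sub_nonneg.2 hs1) hs.le]; simp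
        _ ≤ _ := by
          gcongr
    have h1 : ENNReal.ofReal (Real.pi * (d / 2) ^ 2) * a ≤ (K * a) ^ (1 - s) * I := by
      calc _ ≤ ∫⁻ z in ball x₀ (d / 2), ‖u z‖ₑ :=
            HarmonicOnNhd.ofReal_sq_mul_enorm_le_lintegral_ball (by positivity)
              (hu.mono (hsub.trans ball_subset_closedBall))
        _ ≤ ∫⁻ z in ball x₀ (d / 2), (K * a) ^ (1 - s) * ‖u z‖ₑ ^ s :=
            setLIntegral_mono' measurableSet_ball hle
        _ = (K * a) ^ (1 - s) * ∫⁻ z in ball x₀ (d / 2), ‖u z‖ₑ ^ s :=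
            lintegral_const_mul' _ _
              (ENNReal.rpow_ne_top_of_nonneg (sub_nonneg.2 hs1) (by finiteness))
        _ ≤ _ := by
          rw [hI]
          gcongr
    have ha1 : a = a ^ (1 - s) * a ^ s := by
      rw [← ENNReal.rpow_add_of_nonneg _ _ (sub_nonneg.2 hs1) hs.le]; simp
    have h2 : a ^ (1 - s) * (ENNReal.ofReal (Real.pi * (d / 2) ^ 2) * a ^ s) ≤
        a ^ (1 - s) * (K ^ (1 - s) * I) := by
      calc _ = ENNReal.ofReal (Real.pi * (d / 2) ^ 2) * (a ^ (1 - s) * a ^ s) := by ring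
        _ = ENNReal.ofReal (Real.pi * (d / 2) ^ 2) * a := by rw [← ha1]
        _ ≤ _ := h1
        _ = _ := by rw [ENNReal.mul_rpow_of_nonneg _ _ (sub_nonneg.2 hs1)]; ring
    have h3 := (ENNReal.mul_le_mul_iff_right
      (ENNReal.rpow_pos (pos_iff_ne_zero.2 ha0) hat).ne'
      (ENNReal.rpow_ne_top_of_nonneg (sub_nonneg.2 hs1) hat)).1 h2
    calc ENNReal.ofReal (d ^ 2) * a ^ s
        ≤ ENNReal.ofReal (4 * (Real.pi * (d / 2) ^ 2)) * a ^ s := by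
          gcongr
          nlinarith [Real.pi_gt_three, sq_nonneg d]
      _ = 4 * (ENNReal.ofReal (Real.pi * (d / 2) ^ 2) * a ^ s) := by
          rw [ENNReal.ofReal_mul (by norm_num)]; norm_num [mul_assoc]
      _ ≤ 4 * (K ^ (1 - s) * I) := by gcongr
      _ = _ := by ring
  calc ENNReal.ofReal (R ^ 2) * ‖u x‖ₑ ^ s
      = 4 * (ENNReal.ofReal (R ^ 2 / 4) * ‖u x‖ₑ ^ s) := by
        rw [← mul_assoc, show (4 : ℝ≥0∞) = ENNReal.ofReal 4 by norm_num,
          ← ENNReal.ofReal_mul (by norm_num)]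
        congr 2; ring
    _ ≤ 4 * (4 * K ^ (1 - s) * I) := mul_le_mul_right (hstep1.trans hstep2) _
    _ = _ := by ring

open InnerProductSpace in
/-- The Hardy–Littlewood inequality: all positive powers of the modulus of a harmonic function
are dominated by their means over discs. -/
theorem exists_enorm_rpow_le_lintegral_ball {s : ℝ} (hs : 0 < s) :
    ∃ C : ℝ≥0, ∀ (u : ℂ → ℝ) (c : ℂ) (R : ℝ), 0 < R → HarmonicOnNhd u (closedBall c R) →
      ∀ x ∈ ball c (R / 2),
        ENNReal.ofReal (R ^ 2) * ‖u x‖ₑ ^ s ≤ C * ∫⁻ z in ball c R, ‖u z‖ₑ ^ s := by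
  rcases le_or_gt s 1 with hs1 | hs1
  · exact exists_enorm_rpow_le_lintegral_ball_of_le_one hs hs1
  obtain ⟨C, hC⟩ := exists_enorm_rpow_le_lintegral_ball_of_le_one one_pos le_rfl
  refine ⟨C ^ s * NNReal.pi ^ (s - 1), fun u c R hR hu x hx ↦ ?_⟩
  have h1 := hC u c R hR hu x hx
  simp only [ENNReal.rpow_one] at h1
  set ρ : ℝ≥0∞ := ENNReal.ofReal (R ^ 2) with hρ
  have hρ0 : ρ ≠ 0 := by simp [hρ, hR.ne']
  have hρt : ρ ≠ ∞ := ENNReal.ofReal_ne_top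
  have hconj := Real.HolderConjugate.conjExponent hs1
  have hm : AEMeasurable (fun z ↦ ‖u z‖ₑ) (volume.restrict (ball c R)) :=
    ((hu.continuousOn.mono ball_subset_closedBall).aemeasurable measurableSet_ball).enorm
  -- For `s > 1`, Hölder against the constant `1` reduces to the exponent `1`.
  have h2 := ENNReal.lintegral_mul_le_Lp_mul_Lq (volume.restrict (ball c R)) hconj hm
    (aemeasurable_const (b := (1 : ℝ≥0∞)))
  simp only [Pi.mul_apply, mul_one, ENNReal.one_rpow, lintegral_const,
    Measure.restrict_apply_univ, Complex.volume_ball, one_mul] at h2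
  have h3 : (ρ * ‖u x‖ₑ) ^ s ≤
      C ^ s * ((∫⁻ z in ball c R, ‖u z‖ₑ ^ s) * (ρ * NNReal.pi) ^ (s - 1)) := by
    calc _ ≤ (C * ∫⁻ z in ball c R, ‖u z‖ₑ) ^ s := by gcongr
      _ ≤ (C * ((∫⁻ a in ball c R, ‖u a‖ₑ ^ s) ^ (1 / s) *
          (ENNReal.ofReal R ^ 2 * NNReal.pi) ^ (1 / s.conjExponent))) ^ s := by gcongr
      _ = _ := by
        rw [ENNReal.mul_rpow_of_nonneg _ _ hs.le, ENNReal.mul_rpow_of_nonneg _ _ hs.le,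
          ← ENNReal.rpow_mul, ← ENNReal.rpow_mul, one_div_mul_cancel hs.ne', ENNReal.rpow_one,
          ← ENNReal.ofReal_pow hR.le]
        congr 3
        rw [Real.conjExponent]
        have : s - 1 ≠ 0 := by linarith
        field_simp
  rw [ENNReal.mul_rpow_of_nonneg _ _ hs.le,
    ENNReal.mul_rpow_of_nonneg _ _ (by linarith : 0 ≤ s - 1)] at h3
  have h4 : ρ ^ s = ρ ^ (s - 1) * ρ := by
    conv_rhs => rw [← ENNReal.rpow_one ρ, ← ENNReal.rpow_mul, one_mul]
    rw [← ENNReal.rpow_add _ _ hρ0 hρt]; congr 1; ring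
  rw [h4] at h3
  have h5 : ρ ^ (s - 1) ≠ 0 := by simp [hρ0, hρt]
  have h6 : ρ ^ (s - 1) ≠ ∞ := ENNReal.rpow_ne_top_of_nonneg (by linarith) hρt
  refine (ENNReal.mul_le_mul_iff_right h5 h6).1 ?_
  calc _ = ρ ^ (s - 1) * ρ * ‖u x‖ₑ ^ s := by ring
    _ ≤ _ := h3
    _ = _ := by
      rw [ENNReal.coe_mul, ENNReal.coe_rpow_of_nonneg _ hs.le,
        ENNReal.coe_rpow_of_nonneg _ (by linarith)]
      ring

/-! ### Gradient estimate -/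

/-- A gradient estimate: the derivative of an analytic function is bounded by its real part. -/
theorem norm_deriv_le_of_forall_abs_re_le {f : ℂ → ℂ} {c : ℂ} {R M : ℝ} (hR : 0 < R)
    (hf : DifferentiableOn ℂ f (ball c R)) (hM : ∀ z ∈ ball c R, |(f z).re| ≤ M) :
    ‖deriv f c‖ ≤ 8 * M / R := by
  -- `M` may vanish, while Borel–Carathéodory is applied with a positive bound. It gives `4M'` on
  -- the circle of radius `R / 2`, and Cauchy's estimate then gives `8M' / R`.
  have main : ∀ M' > M, ‖deriv f c‖ ≤ 8 * M' / R := by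
    intro M' hMM'
    have hM0 : 0 < M' := lt_of_le_of_lt
      ((abs_nonneg _).trans (hM c (mem_ball_self hR))) hMM'
    set g : ℂ → ℂ := fun w ↦ f (c + w) - f c with hg
    have hmaps : MapsTo (fun w ↦ c + w) (ball 0 R) (ball c R) := fun w hw ↦ by simpa using hw
    have hgd : DifferentiableOn ℂ g (ball 0 R) :=
      (hf.comp (by fun_prop) hmaps).sub_const _
    have hgre : MapsTo g (ball 0 R) {z | z.re ≤ 2 * M'} := by
      intro w hw
      have h1 := abs_le.1 (hM _ (hmaps hw))
      have h2 := abs_le.1 (hM c (mem_ball_self hR))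
      simp only [hg, Set.mem_ofPred_eq, Complex.sub_re]
      linarith
    have hball : closedBall (0 : ℂ) (R / 2) ⊆ ball 0 R := closedBall_subset_ball (by linarith)
    have hder : deriv g 0 = deriv f c := by
      simp only [hg, deriv_sub_const]
      simpa using deriv_comp_const_add (f := f) c 0
    rw [← hder]
    have hsph : ∀ z ∈ sphere (0 : ℂ) (R / 2), ‖g z‖ ≤ 4 * M' := by
      intro z hz
      have hzn : ‖z‖ = R / 2 := by simpa using hz
      have := Complex.borelCaratheodory_zero (by positivity) hgd hgre hR
        (hball (sphere_subset_closedBall hz)) (by simp [hg])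
      rw [hzn] at this
      refine this.trans_eq ?_
      field_simp
      ring
    have := Complex.norm_deriv_le_of_forall_mem_sphere_norm_le (half_pos hR)
      ((hgd.mono (closure_ball_subset_closedBall.trans hball)).diffContOnCl) hsph
    refine this.trans_eq ?_
    field_simp
    ring
  refine le_of_forall_pos_le_add fun ε hε ↦ ?_
  refine (main (M + ε * R / 8) (by have : 0 < ε * R / 8 := by positivity
                                   linarith)).trans_eq ?_
  field_simp

/-! ### The weighted measure and the geometry of the balls -/

instance sFinite_weightedArea (w : ℂ → ℝ) : SFinite (weightedArea w) := by
  unfold weightedArea; infer_instance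

theorem ae_mem_unitDisc_weightedArea (w : ℂ → ℝ) : ∀ᵐ z ∂(weightedArea w), z ∈ unitDisc :=
  (withDensity_absolutelyContinuous _ _) (ae_restrict_mem measurableSet_ball)

theorem weightedArea_apply (w : ℂ → ℝ) {s : Set ℂ} (hs : MeasurableSet s) :
    weightedArea w s = ∫⁻ z in s ∩ unitDisc, ENNReal.ofReal (w z) := by
  rw [weightedArea, withDensity_apply _ hs, Measure.restrict_restrict hs]

theorem measurable_deltaB : Measurable deltaB := by unfold deltaB; fun_prop

theorem deltaB_pos {z : ℂ} (hz : z ∈ unitDisc) : 0 < deltaB z := by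
  have : ‖z‖ < 1 := by simpa [unitDisc] using hz
  simpa [deltaB] using this

theorem deltaB_le_add_dist (x y : ℂ) : deltaB x ≤ deltaB y + dist x y := by
  have := norm_sub_norm_le y x
  rw [dist_comm, dist_eq_norm]
  unfold deltaB
  linarith

theorem closedBall_half_deltaB_subset {z : ℂ} (hz : z ∈ unitDisc) :
    closedBall z (deltaB z / 2) ⊆ unitDisc := by
  refine (closedBall_subset_ball' (ε₂ := 1) ?_)
  have := deltaB_pos hz
  rw [dist_zero_right]
  unfold deltaB at *
  linarith

/-- The radial projection `z / |z|` lies at distance `deltaB z` from `z`. This makes the ball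
admissible in the Bekollé–Bonami condition. -/
theorem closure_ball_two_mul_deltaB_inter_sphere {z : ℂ} (hz : z ∈ unitDisc) :
    (closure (ball z (2 * deltaB z)) ∩ sphere (0 : ℂ) 1).Nonempty := by
  have hδ := deltaB_pos hz
  rw [closure_ball _ (by positivity)]
  rcases eq_or_ne z 0 with rfl | h0
  · refine ⟨1, ?_, by simp⟩
    simp [deltaB]
  · have hn : ‖z‖ ≠ 0 := norm_ne_zero_iff.2 h0
    refine ⟨z / ‖z‖, ?_, by simp [hn]⟩
    have h1 : z / ‖z‖ - z = z / ‖z‖ * (deltaB z : ℂ) := by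
      have : (‖z‖ : ℂ) ≠ 0 := by exact_mod_cast hn
      simp only [deltaB, Complex.ofReal_sub, Complex.ofReal_one]
      field_simp
    rw [mem_closedBall, dist_eq_norm, h1, norm_mul, norm_div, Complex.norm_real, Complex.norm_real,
      norm_norm, div_self hn, one_mul, Real.norm_of_nonneg hδ.le]
    linarith

/-! ### Integrating local averages -/

/-- If a function is controlled by the averages of `g` over hyperbolic discs, with respect to
a measure on the unit disc, then its integral is controlled by that of `g`. -/
theorem lintegral_le_of_mul_measure_ball_le {μ : Measure ℂ} [SFinite μ]
    (hμD : ∀ᵐ z ∂μ, z ∈ unitDisc)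
    (hμ0 : ∀ z ∈ unitDisc, μ (ball z (2 * deltaB z)) ≠ 0)
    (hμt : ∀ z ∈ unitDisc, μ (ball z (2 * deltaB z)) ≠ ∞)
    {E g : ℂ → ℝ≥0∞} (hg : Measurable g) {C : ℝ≥0}
    (hE : ∀ z ∈ unitDisc, E z * μ (ball z (2 * deltaB z)) ≤
      C * ∫⁻ ζ in ball z (deltaB z / 2), g ζ ∂μ) :
    ∫⁻ z, E z ∂μ ≤ C * ∫⁻ z, g z ∂μ := by
  -- If `dist ζ z < deltaB z / 2`, then `ball ζ (deltaB ζ) ⊆ ball z (2 * deltaB z)` and `z ∈ ball ζ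
  -- (deltaB ζ)`. Hence `W ζ` serves both as the denominator and as a bound for the mass of such
  -- `z`, without any doubling property.
  set W : ℂ → ℝ≥0∞ := fun ζ ↦ μ (ball ζ (deltaB ζ)) with hW
  have hWm : Measurable W := by
    have hs : MeasurableSet {x : ℂ × ℂ | dist x.2 x.1 < deltaB x.1} :=
      measurableSet_lt (by fun_prop) (measurable_deltaB.comp measurable_fst)
    exact measurable_measure_prodMk_left (ν := μ) hs
  set S : Set (ℂ × ℂ) := {x | dist x.2 x.1 < deltaB x.1 / 2} with hS
  have hSm : MeasurableSet S :=
    measurableSet_lt (by fun_prop) ((measurable_deltaB.comp measurable_fst).div_const _)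
  set G : ℂ → ℝ≥0∞ := fun ζ ↦ C * (g ζ / W ζ) with hG
  have hGm : Measurable G := (hg.div hWm).const_mul _
  set F : ℂ × ℂ → ℝ≥0∞ := S.indicator fun x ↦ G x.2 with hF
  have hFm : Measurable F := (hGm.comp measurable_snd).indicator hSm
  have hpt : ∀ z ∈ unitDisc, E z ≤ ∫⁻ ζ, F (z, ζ) ∂μ := by
    intro z hz
    have h1 : E z ≤ (C * ∫⁻ ζ in ball z (deltaB z / 2), g ζ ∂μ) / μ (ball z (2 * deltaB z)) :=
      (ENNReal.le_div_iff_mul_le (Or.inl (hμ0 z hz)) (Or.inl (hμt z hz))).2 (hE z hz)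
    have h2 : ∫⁻ ζ, F (z, ζ) ∂μ = ∫⁻ ζ in ball z (deltaB z / 2), G ζ ∂μ := by
      rw [← lintegral_indicator measurableSet_ball]
      rfl
    rw [h2]
    refine h1.trans ?_
    rw [div_eq_mul_inv, mul_right_comm, ← lintegral_const_mul _ hg]
    refine setLIntegral_mono hGm fun ζ hζ ↦ ?_
    rw [hG, mul_assoc]
    simp only
    rw [div_eq_mul_inv, mul_comm (g ζ)]
    have hsub : W ζ ≤ μ (ball z (2 * deltaB z)) := by
      refine measure_mono (ball_subset_ball' ?_)
      have := mem_ball.1 hζ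
      have := deltaB_le_add_dist ζ z
      linarith
    gcongr
  calc ∫⁻ z, E z ∂μ ≤ ∫⁻ z, ∫⁻ ζ, F (z, ζ) ∂μ ∂μ := by
        refine lintegral_mono_ae ?_
        filter_upwards [hμD] with z hz using hpt z hz
    _ = ∫⁻ ζ, ∫⁻ z, F (z, ζ) ∂μ ∂μ := lintegral_lintegral_swap hFm.aemeasurable
    _ ≤ ∫⁻ ζ, C * g ζ ∂μ := by
        refine lintegral_mono fun ζ ↦ ?_
        have hm : MeasurableSet {z : ℂ | (z, ζ) ∈ S} := measurable_prodMk_right hSm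
        have h1 : ∫⁻ z, F (z, ζ) ∂μ = G ζ * μ {z : ℂ | (z, ζ) ∈ S} := by
          rw [← setLIntegral_const, ← lintegral_indicator hm]
          rfl
        have h2 : μ {z : ℂ | (z, ζ) ∈ S} ≤ W ζ := by
          refine measure_mono fun z hz ↦ ?_
          have h3 : dist ζ z < deltaB z / 2 := hz
          have := deltaB_le_add_dist z ζ
          rw [mem_ball]
          rw [dist_comm] at h3
          linarith
        rw [h1, hG]
        calc C * (g ζ / W ζ) * μ {z : ℂ | (z, ζ) ∈ S} ≤ C * (g ζ / W ζ) * W ζ := by gcongr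
          _ = C * (g ζ / W ζ * W ζ) := mul_assoc _ _ _
          _ ≤ C * g ζ := by gcongr; exact ENNReal.mul_le_of_le_div le_rfl
    _ = _ := lintegral_const_mul _ hg

/-! ### Consequences of the Bekollé–Bonami condition -/

namespace IsBekolleBonamiWeight

variable {q : ℝ} {w : ℂ → ℝ}

theorem exists_weightedArea_mul_le (hw : IsBekolleBonamiWeight q w) :
    ∃ K : ℝ≥0, ∀ z ∈ unitDisc, weightedArea w (ball z (2 * deltaB z)) *
      (∫⁻ ζ in ball z (2 * deltaB z) ∩ unitDisc, ENNReal.ofReal (w ζ ^ (-1 / (q - 1)))) ^ (q - 1)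
        ≤ K * ENNReal.ofReal (deltaB z ^ 2) ^ q := by
  obtain ⟨C, hC⟩ := hw.bound
  have hq := hw.one_lt
  -- The two averages carry `V ^ (-q)` in total, and `V = 4π (deltaB z)²`.
  refine ⟨C * (4 * NNReal.pi) ^ q, fun z hz ↦ ?_⟩
  have hδ := deltaB_pos hz
  have h := hC z (2 * deltaB z) (by positivity) (closure_ball_two_mul_deltaB_inter_sphere hz)
  rw [← weightedArea_apply w measurableSet_ball] at h
  set V := volume (ball z (2 * deltaB z)) with hV
  have hV0 : V ≠ 0 := (measure_ball_pos _ _ (by positivity)).ne'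
  have hVt : V ≠ ∞ := measure_ball_lt_top.ne
  have hV' : V = (4 * NNReal.pi : ℝ≥0) * ENNReal.ofReal (deltaB z ^ 2) := by
    rw [hV, Complex.volume_ball, ← ENNReal.ofReal_pow (by positivity), mul_pow,
      ENNReal.ofReal_mul (by positivity)]
    push_cast
    norm_num
    ring
  set m := weightedArea w (ball z (2 * deltaB z))
  set σ := ∫⁻ ζ in ball z (2 * deltaB z) ∩ unitDisc, ENNReal.ofReal (w ζ ^ (-1 / (q - 1)))
  have hVq : V ^ q = V * V ^ (q - 1) := by
    conv_rhs => rw [← ENNReal.rpow_one V, ← ENNReal.rpow_mul, one_mul]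
    rw [← ENNReal.rpow_add _ _ hV0 hVt]; congr 1; ring
  calc m * σ ^ (q - 1) = V ^ q * (V⁻¹ * m * (V⁻¹ * σ) ^ (q - 1)) := by
        rw [ENNReal.mul_rpow_of_nonneg _ _ (by linarith : 0 ≤ q - 1), hVq, ENNReal.inv_rpow]
        have h1 : V ^ (q - 1) ≠ 0 := by simp [hV0, hVt]
        have h2 : V ^ (q - 1) ≠ ∞ := ENNReal.rpow_ne_top_of_nonneg (by linarith) hVt
        calc m * σ ^ (q - 1) = (V * V⁻¹) * (V ^ (q - 1) * (V ^ (q - 1))⁻¹) * (m * σ ^ (q - 1)) := by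
              rw [ENNReal.mul_inv_cancel hV0 hVt, ENNReal.mul_inv_cancel h1 h2]; simp
          _ = _ := by ring
    _ ≤ V ^ q * C := by gcongr
    _ = _ := by
        rw [hV', ENNReal.mul_rpow_of_nonneg _ _ (by linarith), ENNReal.coe_mul,
          ENNReal.coe_mul, ENNReal.coe_rpow_of_nonneg _ (by linarith), ENNReal.coe_mul]
        ring

theorem setLIntegral_ofReal_ne_zero {φ : ℂ → ℝ} {z : ℂ} {r : ℝ} (hr : 0 < r)
    (hz : z ∈ unitDisc) (hφm : AEMeasurable φ (volume.restrict unitDisc))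
    (hφ : ∀ᵐ z ∂(volume.restrict unitDisc), 0 < φ z) :
    ∫⁻ ζ in ball z r ∩ unitDisc, ENNReal.ofReal (φ ζ) ≠ 0 := by
  have hle : volume.restrict (ball z r ∩ unitDisc) ≤ volume.restrict unitDisc :=
    Measure.restrict_mono_set _ inter_subset_right
  rw [Ne, lintegral_eq_zero_iff' (hφm.mono_measure hle).ennreal_ofReal]
  intro h
  have h2 : ∀ᵐ ζ ∂(volume.restrict (ball z r ∩ unitDisc)), False := by
    filter_upwards [h, ae_mono hle hφ] with ζ h3 h4
    exact absurd (ENNReal.ofReal_eq_zero.1 h3) (not_le.2 h4)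
  rw [ae_iff] at h2
  simp only [not_false_eq_true, ofPred_true, Measure.restrict_apply_univ] at h2
  exact ((isOpen_ball.inter isOpen_ball).measure_pos volume
    ⟨z, mem_ball_self hr, hz⟩).ne' h2

theorem weightedArea_ball_ne_zero (hw : IsBekolleBonamiWeight q w) {z : ℂ} (hz : z ∈ unitDisc) :
    weightedArea w (ball z (2 * deltaB z)) ≠ 0 := by
  have := deltaB_pos hz
  rw [weightedArea_apply w measurableSet_ball]
  exact setLIntegral_ofReal_ne_zero (by positivity) hz hw.aemeasurable hw.pos

/-- The dual weight has nonzero mass, so an infinite mass of `w` would make the bounded product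
infinite. -/
theorem weightedArea_ball_ne_top (hw : IsBekolleBonamiWeight q w) {z : ℂ} (hz : z ∈ unitDisc) :
    weightedArea w (ball z (2 * deltaB z)) ≠ ∞ := by
  have hδ := deltaB_pos hz
  have hq := hw.one_lt
  obtain ⟨K, hK⟩ := hw.exists_weightedArea_mul_le
  intro htop
  have h := hK z hz
  have hσ : ∫⁻ ζ in ball z (2 * deltaB z) ∩ unitDisc,
      ENNReal.ofReal (w ζ ^ (-1 / (q - 1))) ≠ 0 := by
    refine setLIntegral_ofReal_ne_zero (by positivity) hz (hw.aemeasurable.pow_const _) ?_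
    filter_upwards [hw.pos] with ζ hζ using Real.rpow_pos_of_pos hζ _
  rw [htop, ENNReal.top_mul (by simp [hσ, hq.le])] at h
  exact (ENNReal.mul_ne_top ENNReal.coe_ne_top (ENNReal.rpow_ne_top_of_nonneg (by linarith)
    ENNReal.ofReal_ne_top)) (top_le_iff.1 h)

/-- Hölder's inequality for a weight and its dual. -/
theorem lintegral_rpow_rpow_le (hw : IsBekolleBonamiWeight q w) {p : ℝ} {s : Set ℂ}
    (hs : MeasurableSet s) (hsD : s ⊆ unitDisc) {h : ℂ → ℝ≥0∞}
    (hh : AEMeasurable h (volume.restrict s)) :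
    (∫⁻ z in s, h z ^ (p / q)) ^ q ≤ (∫⁻ z in s, h z ^ p ∂(weightedArea w)) *
      (∫⁻ z in s, ENNReal.ofReal (w z ^ (-1 / (q - 1)))) ^ (q - 1) := by
  have hq := hw.one_lt
  have hq0 : 0 < q := by linarith
  have hq1 : 0 < q - 1 := by linarith
  have hle : volume.restrict s ≤ volume.restrict unitDisc := Measure.restrict_mono_set _ hsD
  have hwm : AEMeasurable w (volume.restrict s) := hw.aemeasurable.mono_measure hle
  have hpos : ∀ᵐ z ∂(volume.restrict s), 0 < w z := ae_mono hle hw.pos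
  have hconj := Real.HolderConjugate.conjExponent hq
  have hmu : ∫⁻ z in s, h z ^ p ∂(weightedArea w) =
      ∫⁻ z in s, (h z ^ (p / q) * ENNReal.ofReal (w z) ^ (1 / q)) ^ q := by
    rw [weightedArea, restrict_withDensity hs, Measure.restrict_restrict hs,
      inter_eq_self_of_subset_left hsD,
      lintegral_withDensity_eq_lintegral_mul₀ hwm.ennreal_ofReal (hh.pow_const p)]
    refine lintegral_congr fun z ↦ ?_
    rw [ENNReal.mul_rpow_of_nonneg _ _ hq0.le, ← ENNReal.rpow_mul, ← ENNReal.rpow_mul,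
      div_mul_cancel₀ _ hq0.ne', div_mul_cancel₀ _ hq0.ne', ENNReal.rpow_one, Pi.mul_apply,
      mul_comm]
  have hσ : ∫⁻ z in s, ENNReal.ofReal (w z ^ (-1 / (q - 1))) =
      ∫⁻ z in s, (ENNReal.ofReal (w z) ^ (-(1 / q))) ^ q.conjExponent := by
    refine lintegral_congr_ae ?_
    filter_upwards [hpos] with z hz
    rw [← ENNReal.rpow_mul, ENNReal.ofReal_rpow_of_pos hz, Real.conjExponent]
    congr 2
    field_simp
  have hH := ENNReal.lintegral_mul_le_Lp_mul_Lq (volume.restrict s) hconj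
    ((hh.pow_const (p / q)).mul (hwm.ennreal_ofReal.pow_const (1 / q)))
    (hwm.ennreal_ofReal.pow_const (-(1 / q)))
  simp only [Pi.mul_apply] at hH
  rw [← hmu, ← hσ] at hH
  -- The factors `w^(1/q)` and `w^(-1/q)` cancel only where `w > 0`, hence almost everywhere.
  have hL : ∫⁻ z in s, h z ^ (p / q) = ∫⁻ z in s, h z ^ (p / q) *
      ENNReal.ofReal (w z) ^ (1 / q) * ENNReal.ofReal (w z) ^ (-(1 / q)) := by
    refine lintegral_congr_ae ?_
    filter_upwards [hpos] with z hz
    rw [mul_assoc, ← ENNReal.rpow_add _ _ (by simpa using hz) ENNReal.ofReal_ne_top]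
    simp
  rw [← hL] at hH
  calc _ ≤ (_ * _ : ℝ≥0∞) ^ q := ENNReal.rpow_le_rpow hH hq0.le
    _ = _ := by
      rw [ENNReal.mul_rpow_of_nonneg _ _ hq0.le, ← ENNReal.rpow_mul, ← ENNReal.rpow_mul,
        one_div_mul_cancel hq0.ne', ENNReal.rpow_one, Real.conjExponent]
      congr 2
      field_simp

end IsBekolleBonamiWeight

/-! ### Local estimates for `δ f'` and the norm inequality -/

open InnerProductSpace in
theorem exists_enorm_deltaB_mul_deriv_rpow_le {s : ℝ} (hs : 0 < s) :
    ∃ C : ℝ≥0, ∀ (u : ℂ → ℝ), HarmonicOnNhd u unitDisc → ∀ f : ℂ → ℂ, IsAnalyticCompletion u f →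
      ∀ z ∈ unitDisc, ENNReal.ofReal (deltaB z ^ 2) * ‖(deltaB z : ℂ) * deriv f z‖ₑ ^ s ≤
        C * ∫⁻ ζ in ball z (deltaB z / 2), ‖u ζ‖ₑ ^ s := by
  obtain ⟨C, hC⟩ := exists_enorm_rpow_le_lintegral_ball hs
  -- `32` is the gradient constant `8` at radius `δ / 4`, multiplied by `δ`; `4` comes from `δ² = 4
  -- (δ / 2)²`.
  refine ⟨4 * 32 ^ s * C, fun u hu f hf z hz ↦ ?_⟩
  have hδ := deltaB_pos hz
  set δ := deltaB z with hδdef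
  have hsub : closedBall z (δ / 2) ⊆ unitDisc := closedBall_half_deltaB_subset hz
  have h1 := hC u z (δ / 2) (by positivity) (hu.mono hsub)
  set X : ℝ≥0∞ := C * ∫⁻ ζ in ball z (δ / 2), ‖u ζ‖ₑ ^ s with hX
  set ρ : ℝ≥0∞ := ENNReal.ofReal ((δ / 2) ^ 2) with hρ
  have hρ0 : ρ ≠ 0 := by simp [hρ, hδ.ne']
  have hρt : ρ ≠ ∞ := ENNReal.ofReal_ne_top
  have hD : ENNReal.ofReal (δ ^ 2) = 4 * ρ := by
    rw [hρ, show (4 : ℝ≥0∞) = ENNReal.ofReal 4 by norm_num, ← ENNReal.ofReal_mul (by norm_num)]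
    congr 1; ring
  have hsup : ∀ x ∈ ball z (δ / 2 / 2), ‖u x‖ₑ ≤ (X / ρ) ^ (1 / s) := by
    intro x hx
    rw [one_div, ENNReal.le_rpow_inv_iff hs,
      ENNReal.le_div_iff_mul_le (Or.inl hρ0) (Or.inl hρt), mul_comm]
    exact h1 x hx
  have hder : ‖(δ : ℂ) * deriv f z‖ₑ ≤ 32 * (X / ρ) ^ (1 / s) := by
    rcases eq_or_ne ((X / ρ) ^ (1 / s)) ∞ with htop | htop
    · rw [htop, ENNReal.mul_top (by norm_num)]; exact le_top
    have hsub' : ball z (δ / 2 / 2) ⊆ unitDisc :=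
      (ball_subset_closedBall.trans (closedBall_subset_closedBall (by linarith))).trans hsub
    have h2 := norm_deriv_le_of_forall_abs_re_le (f := f) (c := z) (R := δ / 2 / 2)
      (M := ((X / ρ) ^ (1 / s)).toReal) (by positivity) (hf.1.mono hsub') (fun x hx ↦ by
        rw [hf.2 x (hsub' hx), ← Real.norm_eq_abs, ← toReal_enorm]
        exact ENNReal.toReal_mono htop (hsup x hx))
    have h3 : ‖(δ : ℂ) * deriv f z‖ ≤ 32 * ((X / ρ) ^ (1 / s)).toReal := by
      rw [norm_mul, Complex.norm_real, Real.norm_of_nonneg hδ.le]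
      calc δ * ‖deriv f z‖ ≤ δ * (8 * ((X / ρ) ^ (1 / s)).toReal / (δ / 2 / 2)) := by gcongr
        _ = _ := by field_simp; ring
    have h4 := ENNReal.ofReal_le_ofReal h3
    rwa [ofReal_norm, ENNReal.ofReal_mul (by norm_num), ENNReal.ofReal_toReal htop,
      show ENNReal.ofReal 32 = 32 by norm_num] at h4
  calc ENNReal.ofReal (δ ^ 2) * ‖(δ : ℂ) * deriv f z‖ₑ ^ s
      ≤ 4 * ρ * (32 * (X / ρ) ^ (1 / s)) ^ s := by rw [hD]; gcongr
    _ = 4 * 32 ^ s * (X / ρ * ρ) := by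
      rw [ENNReal.mul_rpow_of_nonneg _ _ hs.le, ← ENNReal.rpow_mul, one_div_mul_cancel hs.ne',
        ENNReal.rpow_one]
      ring
    _ = 4 * 32 ^ s * X := by rw [ENNReal.div_mul_cancel hρ0 hρt]
    _ = _ := by
      rw [hX, ENNReal.coe_mul, ENNReal.coe_mul, ENNReal.coe_rpow_of_nonneg _ hs.le]
      push_cast
      ring

open InnerProductSpace in
theorem exists_enorm_deltaB_mul_deriv_rpow_mul_weightedArea_le {p q : ℝ} (hp : 0 < p) {w : ℂ → ℝ}
    (hw : IsBekolleBonamiWeight q w) :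
    ∃ C : ℝ≥0, ∀ (u : ℂ → ℝ), HarmonicOnNhd u unitDisc → ∀ f : ℂ → ℂ, IsAnalyticCompletion u f →
      ∀ z ∈ unitDisc, ‖(deltaB z : ℂ) * deriv f z‖ₑ ^ p *
        weightedArea w (ball z (2 * deltaB z)) ≤
        C * ∫⁻ ζ in ball z (deltaB z / 2), ‖u ζ‖ₑ ^ p ∂(weightedArea w) := by
  have hq := hw.one_lt
  have hq0 : 0 < q := by linarith
  obtain ⟨C, hC⟩ := exists_enorm_deltaB_mul_deriv_rpow_le (div_pos hp hq0)
  obtain ⟨K, hK⟩ := hw.exists_weightedArea_mul_le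
  refine ⟨C ^ q * K, fun u hu f hf z hz ↦ ?_⟩
  have hδ := deltaB_pos hz
  have h1 := ENNReal.rpow_le_rpow (hC u hu f hf z hz) hq0.le
  have hsub : ball z (deltaB z / 2) ⊆ unitDisc :=
    ball_subset_closedBall.trans (closedBall_half_deltaB_subset hz)
  have h2 := hw.lintegral_rpow_rpow_le (p := p) (s := ball z (deltaB z / 2)) measurableSet_ball hsub
    ((hu.continuousOn.mono hsub).aemeasurable measurableSet_ball).enorm
  have h3 := hK z hz
  set Δ := ENNReal.ofReal (deltaB z ^ 2) with hΔ
  have hΔ0 : Δ ^ q ≠ 0 := by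
    have h0 : Δ ≠ 0 := (ENNReal.ofReal_pos.2 (by positivity)).ne'
    have ht : Δ ≠ ∞ := ENNReal.ofReal_ne_top
    simp [h0, ht]
  have hΔt : Δ ^ q ≠ ∞ := ENNReal.rpow_ne_top_of_nonneg hq0.le ENNReal.ofReal_ne_top
  set E := ‖(deltaB z : ℂ) * deriv f z‖ₑ
  set m := weightedArea w (ball z (2 * deltaB z))
  set J := ∫⁻ ζ in ball z (deltaB z / 2), ‖u ζ‖ₑ ^ p ∂(weightedArea w)
  rw [ENNReal.mul_rpow_of_nonneg _ _ hq0.le, ENNReal.mul_rpow_of_nonneg _ _ hq0.le,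
    ← ENNReal.rpow_mul, div_mul_cancel₀ _ hq0.ne'] at h1
  refine (ENNReal.mul_le_mul_iff_right hΔ0 hΔt).1 ?_
  have hmono : ∫⁻ ζ in ball z (deltaB z / 2), ENNReal.ofReal (w ζ ^ (-1 / (q - 1))) ≤
      ∫⁻ ζ in ball z (2 * deltaB z) ∩ unitDisc, ENNReal.ofReal (w ζ ^ (-1 / (q - 1))) :=
    lintegral_mono_set (subset_inter (ball_subset_ball (by linarith)) hsub)
  set σ := ∫⁻ ζ in ball z (2 * deltaB z) ∩ unitDisc, ENNReal.ofReal (w ζ ^ (-1 / (q - 1)))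
  have hq1 : 0 ≤ q - 1 := by linarith
  calc Δ ^ q * (E ^ p * m) = Δ ^ q * E ^ p * m := (mul_assoc _ _ _).symm
    _ ≤ C ^ q * (J * σ ^ (q - 1)) * m := by
      refine mul_le_mul_left (h1.trans (mul_le_mul_right (h2.trans ?_) _)) _
      gcongr
    _ = C ^ q * J * (m * σ ^ (q - 1)) := by ring
    _ ≤ C ^ q * J * (K * Δ ^ q) := by gcongr
    _ = _ := by
      rw [ENNReal.coe_mul, ENNReal.coe_rpow_of_nonneg _ hq0.le]
      ring

theorem weightedNorm_eq {F : Type*} [NormedAddCommGroup F] {p : ℝ} (hp : 0 < p) (w : ℂ → ℝ)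
    (g : ℂ → F) : weightedNorm p w g = (∫⁻ z, ‖g z‖ₑ ^ p ∂(weightedArea w)) ^ (1 / p) := by
  rw [weightedNorm, eLpNorm_eq_lintegral_rpow_enorm_toReal (by simpa using hp)
    ENNReal.ofReal_ne_top, ENNReal.toReal_ofReal hp.le]

open InnerProductSpace in
/-- For harmonic functions on the disc, `‖δ f'‖ ≤ C ‖u‖` in every `L^p` space with a
Bekollé–Bonami weight. -/
theorem IsBekolleBonamiWeight.exists_weightedNorm_deltaB_mul_deriv_le {p q : ℝ} (hp : 0 < p)
    {w : ℂ → ℝ} (hw : IsBekolleBonamiWeight q w) :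
    ∃ C : ℝ≥0, ∀ u : ℂ → ℝ, HarmonicOnNhd u unitDisc → ∀ f : ℂ → ℂ, IsAnalyticCompletion u f →
      weightedNorm p w (fun z => (deltaB z : ℂ) * deriv f z) ≤ C * weightedNorm p w u := by
  obtain ⟨C, hC⟩ := exists_enorm_deltaB_mul_deriv_rpow_mul_weightedArea_le hp hw
  refine ⟨C ^ (1 / p), fun u hu f hf ↦ ?_⟩
  classical
  -- `u` is arbitrary off the disc; its extension by zero is globally measurable, as the Tonelli
  -- argument requires.
  set v : ℂ → ℝ := unitDisc.piecewise u fun _ ↦ 0 with hv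
  have hvu : ∀ z ∈ unitDisc, v z = u z := fun z hz ↦ piecewise_eq_of_mem _ _ _ hz
  have hvm : Measurable v :=
    hu.continuousOn.measurable_piecewise continuousOn_const measurableSet_ball
  have hmain := lintegral_le_of_mul_measure_ball_le (ae_mem_unitDisc_weightedArea w)
    (fun z hz ↦ hw.weightedArea_ball_ne_zero hz) (fun z hz ↦ hw.weightedArea_ball_ne_top hz)
    (E := fun z ↦ ‖(deltaB z : ℂ) * deriv f z‖ₑ ^ p) (g := fun z ↦ ‖v z‖ₑ ^ p)
    (hvm.enorm.pow_const p) (C := C) (fun z hz ↦ by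
      refine (hC u hu f hf z hz).trans_eq ?_
      congr 1
      refine setLIntegral_congr_fun measurableSet_ball fun ζ hζ ↦ ?_
      rw [hvu ζ (closedBall_half_deltaB_subset hz (ball_subset_closedBall hζ))])
  have hint : ∫⁻ z, ‖v z‖ₑ ^ p ∂(weightedArea w) = ∫⁻ z, ‖u z‖ₑ ^ p ∂(weightedArea w) := by
    refine lintegral_congr_ae ?_
    filter_upwards [ae_mem_unitDisc_weightedArea w] with z hz
    rw [hvu z hz]
  rw [hint] at hmain
  rw [weightedNorm_eq hp, weightedNorm_eq hp, ENNReal.coe_rpow_of_nonneg _ (by positivity),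
    ← ENNReal.mul_rpow_of_nonneg _ _ (by positivity)]
  gcongr

/-- The boundedness of the shifted evaluations is not used: for a Bekollé–Bonami weight the
Hardy–Littlewood inequality already bounds `δ f'` by `u`. -/
theorem mainTheorem3 (p : ℝ) (hp : 0 < p) (q : ℝ) (w : ℂ → ℝ)
    (hw : IsBekolleBonamiWeight q w)
    (hshift : ∃ η₀ ∈ Set.Ioo (0 : ℝ) 1, ∀ η ∈ Set.Ioo (0 : ℝ) η₀,
      IsBoundedOnHarmonic p w (shiftedEval 1 η) ∧
      IsBoundedOnHarmonic p w (shiftedEval Complex.I η)) :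
    ∃ C : ℝ≥0, ∀ u : ℂ → ℝ, InnerProductSpace.HarmonicOnNhd u unitDisc →
      ∀ f : ℂ → ℂ, IsAnalyticCompletion u f →
        weightedNorm p w (fun z => (deltaB z : ℂ) * deriv f z) ≤ C * weightedNorm p w u := by
  exact hw.exists_weightedNorm_deltaB_mul_deriv_le hp
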